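/- Let $K$ be an algebraically closed field of arbitrary characteristic and $R=K[x_0,x_1,x_2]$ the homogeneous coordinate ring of $\mathbb P^2$. Let $A\subset\mathbb P^2$ be a fat point subscheme, i.e. the scheme defined by $I_A=\bigcap_{i=1}^r I_{p_i}^{m_i}$, where $p_1,\dots,p_r$ are points of $\mathbb P^2$, the $m_i$ are non-negative integers, and $I_{p}$ is the ideal generated by the forms vanishing at $p$. Let $L_1,\dots,L_{n+1}$ ($n\ge 0$) be lines, not necessarily distinct, let $F_j$ be a linear form defining $L_j$, put $A_0=A$, and let $A_j=A_{j-1}:L_j$ be the scheme defined by the ideal $(I_{A_{j-1}}:F_j)$ for $1\le j\le n+1$. Assume that the sequence is totally reducing, i.e. $A_{n+1}=\varnothing$, and let $\mathbf d=(d_1,\dots,d_{n+1})$ be the associated reduction vector, where $d_j=\deg(L_j\cap A_{j-1})$ is the degree of the scheme-theoretic intersection. Suppose that $\mathbf d$ is GMS, that is, $\mathbf d$ is non-negative and non-increasing and $d_i-d_j\ge j-i-1$ whenever $1\le i<j\le n+1$. Then for every integer $t$ $$\max_{0\le i\le n+1}\Bigl(\binom{t-i+2}{2}-\sum_{i+1\le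 j\le n+1}d_j\Bigr)\;=\;\binom{t-n+1}{2}+\sum_{i=0}^{n}\binom{t-i-d_{i+1}+1}{1},$$ where $\binom{a}{b}=0$ if $a<b$ (in particular for negative $a$). Moreover, for every integer $t\ge 0$ both sides are equal to $h_{I_A}(t)=\dim_K (I_A)_t=h^0(\mathbb P^2,\mathcal I_A(t))$. Hence the Hilbert function $h_A(t)=\dim_K (R/I_A)_t$ equals $\binom{t+2}{2}$ minus this common value, and so it is determined by $\mathbf d$. -/

import Mathlib

namespace FatPoints

open MvPolynomial

/-- The ideal `I_p` of a point `p` of the projective plane: the ideal generated by all forms that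
vanish at `p` (for a form this does not depend on the chosen homogeneous coordinates of `p`). -/
noncomputable def pointIdeal {K : Type*} [Field K] (p : Projectivization K (Fin 3 → K)) :
    Ideal (MvPolynomial (Fin 3) K) :=
  Ideal.span {f | (∃ e : ℕ, f.IsHomogeneous e) ∧ eval p.rep f = 0}

/-- The ideal `I_Z = ⋂ i, I_{p i} ^ (m i)` of the fat point scheme `Z = ∑ i, m i • p i`. -/
noncomputable def fatPointIdeal {K : Type*} [Field K] {r : ℕ}
    (p : Fin r → Projectivization K (Fin 3 → K)) (m : Fin r → ℕ) :
    Ideal (MvPolynomial (Fin 3) K) :=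
  ⨅ i, pointIdeal (p i) ^ m i

/-- The homogeneous component `I_t`, the space of all forms of degree `t` that lie in `I`. -/
noncomputable def gradedPart {K : Type*} [Field K] (I : Ideal (MvPolynomial (Fin 3) K)) (t : ℕ) :
    Submodule K (homogeneousSubmodule (Fin 3) K t) :=
  (I.restrictScalars K).comap (homogeneousSubmodule (Fin 3) K t).subtype

/-- The Hilbert function of the ideal `I`: `t ↦ dim_K I_t`. -/
noncomputable def hilbertIdeal {K : Type*} [Field K] (I : Ideal (MvPolynomial (Fin 3) K))
    (t : ℕ) : ℕ :=
  Module.finrank K (gradedPart I t)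

/-- The Hilbert function of the scheme defined by `I`: `t ↦ dim_K (R_t / I_t)`. -/
noncomputable def hilbertScheme {K : Type*} [Field K] (I : Ideal (MvPolynomial (Fin 3) K))
    (t : ℕ) : ℕ :=
  Module.finrank K (homogeneousSubmodule (Fin 3) K t ⧸ gradedPart I t)

/-- The closed subscheme of the projective plane defined by the homogeneous ideal `I` is finite
(or empty) of degree `d`: its Hilbert polynomial is the constant `d`. -/
def HasDegree {K : Type*} [Field K] (I : Ideal (MvPolynomial (Fin 3) K)) (d : ℤ) : Prop :=
  ∀ᶠ t in Filter.atTop, (hilbertScheme I t : ℤ) = d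

/-- A linear form defining a line of the projective plane. -/
def IsLine {K : Type*} [Field K] (F : MvPolynomial (Fin 3) K) : Prop :=
  F.IsHomogeneous 1 ∧ F ≠ 0

/-- The ideals of the successive residuals `A_0 = A`, `A_j = A_{j-1} : L_j` (`1 ≤ j ≤ N`), where
`A` is defined by `I` and the lines `L_1, …, L_N` by the forms `F 0, …, F (N - 1)`: the scheme
`A_j` is defined by the colon ideal `(I_{A_{j-1}} : F (j - 1))`. -/
noncomputable def residualIdeal {K : Type*} [Field K] (I : Ideal (MvPolynomial (Fin 3) K)) {N : ℕ}
    (F : Fin N → MvPolynomial (Fin 3) K) : Fin (N + 1) → Ideal (MvPolynomial (Fin 3) K) :=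
  Fin.induction (motive := fun _ => Ideal (MvPolynomial (Fin 3) K)) I
    (fun j J => Submodule.colon J {F j})

/-- The sequence of lines totally reduces `A`: the last residual is the empty scheme, that is,
the fat point scheme whose (saturated) ideal is the unit ideal. -/
def TotallyReduces {K : Type*} [Field K] (I : Ideal (MvPolynomial (Fin 3) K)) {N : ℕ}
    (F : Fin N → MvPolynomial (Fin 3) K) : Prop :=
  residualIdeal I F (Fin.last N) = ⊤

/-- `d` is the reduction vector: `d_{j+1}` is the degree of the scheme-theoretic intersection
of the line `L_{j+1}` with `A_j`, which is defined by the ideal `I_{A_j} + (F_{j+1})`. -/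
def IsReductionVector {K : Type*} [Field K] (I : Ideal (MvPolynomial (Fin 3) K)) {N : ℕ}
    (F : Fin N → MvPolynomial (Fin 3) K) (d : Fin N → ℤ) : Prop :=
  ∀ j : Fin N, HasDegree (residualIdeal I F j.castSucc ⊔ Ideal.span {F j}) (d j)

/-- A non-negative, non-increasing integer vector `v` is GMS if `v_i - v_j ≥ j - i - 1`
for all `i < j`. -/
def IsGMS {N : ℕ} (v : Fin N → ℤ) : Prop :=
  (∀ i, 0 ≤ v i) ∧ Antitone v ∧ ∀ i j : Fin N, i < j → (j : ℤ) - (i : ℤ) - 1 ≤ v i - v j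

/-- The binomial coefficient with integer upper entry, equal to `0` if `a < k` (used only for
`k = 1, 2`; in particular it is `0` for negative `a`). -/
def binom (a : ℤ) (k : ℕ) : ℤ := (a.toNat.choose k : ℤ)

/-- `h_i' = binom (t - i + 2) 2 - ∑_{i + 1 ≤ j ≤ n + 1} d_j` for `0 ≤ i ≤ n + 1`; here `d_j` is
`d (j - 1)`, and for `i = n + 1` the sum is empty. -/
def lowerTerm {n : ℕ} (d : Fin (n + 1) → ℤ) (t : ℤ) (i : Fin (n + 2)) : ℤ :=
  binom (t - (i : ℤ) + 2) 2 - ∑ j ∈ Finset.univ.filter (fun j : Fin (n + 1) => (i : ℕ) ≤ (j : ℕ)), d j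

/-- The lower bound `max (h_0', …, h_{n+1}')`. -/
def lowerBound {n : ℕ} (d : Fin (n + 1) → ℤ) (t : ℤ) : ℤ :=
  Finset.univ.sup' Finset.univ_nonempty (lowerTerm d t)

/-- The upper bound `binom (t - n + 1) 2 + ∑_{i = 0}^{n} binom (t - i - d_{i+1} + 1) 1`. -/
def upperBound {n : ℕ} (d : Fin (n + 1) → ℤ) (t : ℤ) : ℤ :=
  binom (t - (n : ℤ) + 1) 2 + ∑ i : Fin (n + 1), binom (t - (i : ℤ) - d i + 1) 1

end FatPoints

/-!
Write `I j` for the ideal of the `j`-th residual and `J j = I j + (F j)` for the ideal of its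
intersection with the next line. Multiplication by `F j` gives the exact sequence
`0 → (R / I (j + 1))(-1) → R / I j → R / J j → 0` (`hilbertScheme_succ`), and everything follows from
what it says in each degree, once the Hilbert functions of `R / J j` and `R / I j` are under control.

*Upper bound.* On a line, the Hilbert function of a homogeneous ideal is `t + 1` until the ideal
contains a form and does not increase afterwards: multiplying a nonzero space of binary forms by two
independent linear forms raises its dimension (`finrank_lt_of_mul_mem`). As the Hilbert function of
`R / J j` ends at `d j`, it is at least `min (t + 1) (d j)` everywhere, so passing from `I j` to
`I (j + 1)` loses at most `max (t - d j + 1) 0` forms (`hilbertInt_le`). Summing gives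
`hilbertInt_le_upperBound`. No saturation of `J j` is needed.

*Lower bound.* The degrees `d j` of the intersections with the lines add up
(`hasDegree_residualIdeal`). A general linear form is not a zero divisor modulo `I_A`, hence not modulo
any `I j`, so the Hilbert function of `R / I j` is nondecreasing and bounded by its final value, the
degree (`le_hilbertInt_of_hasDegree`). As `I j`, shifted by `j`, embeds into `I_A` by multiplication
with the product of the first `j` linear forms, `lowerTerm_le_hilbertInt` follows. That `I_p ^ m` is
primary is proved with the Rees algebra: a one-parameter contraction of the plane to `p`, fixing a
linear form `l` with `l(p) = 1`, turns membership in `I_p ^ m` into divisibility by `T ^ m`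
(`mem_pointIdeal_pow_iff`).

*Agreement.* Both bounds are sums over the lines with comparable terms, and the GMS inequalities make
all terms agree for a suitable index `i` (`exists_upperBound_le_lowerTerm`).
-/

namespace FatPoints

open MvPolynomial

/-! ### Hilbert functions and colon ideals by a line -/

section HilbertFunctions

variable {K : Type*} [Field K]

attribute [local instance] MvPolynomial.gradedAlgebra

/-- The forms of degree `t` in `I`, as a space of polynomials: the copy of `gradedPart I t` inside
the polynomial ring. -/
noncomputable def formsIn (I : Ideal (MvPolynomial (Fin 3) K)) (t : ℕ) :
    Submodule K (MvPolynomial (Fin 3) K) :=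
  homogeneousSubmodule (Fin 3) K t ⊓ I.restrictScalars K

theorem mem_formsIn {I : Ideal (MvPolynomial (Fin 3) K)} {t : ℕ} {f : MvPolynomial (Fin 3) K} :
    f ∈ formsIn I t ↔ f.IsHomogeneous t ∧ f ∈ I := Iff.rfl

instance finite_homogeneousSubmodule (t : ℕ) :
    Module.Finite K (homogeneousSubmodule (Fin 3) K t) :=
  Module.Finite.iff_fg.mpr (homogeneousSubmodule_fg (Fin 3) K t)

instance finite_formsIn (I : Ideal (MvPolynomial (Fin 3) K)) (t : ℕ) :
    Module.Finite K (formsIn I t) :=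
  Submodule.finiteDimensional_of_le (inf_le_left (a := homogeneousSubmodule (Fin 3) K t))

theorem finrank_formsIn (I : Ideal (MvPolynomial (Fin 3) K)) (t : ℕ) :
    Module.finrank K (formsIn I t) = hilbertIdeal I t := by
  have h := (Submodule.equivSubtypeMap (homogeneousSubmodule (Fin 3) K t)
    (gradedPart I t)).finrank_eq
  rw [gradedPart, Submodule.map_comap_subtype] at h
  exact h.symm

theorem finrank_homogeneousSubmodule (t : ℕ) :
    Module.finrank K (homogeneousSubmodule (Fin 3) K t) = (t + 2).choose 2 := by
  have hset : {d : Fin 3 →₀ ℕ | d.degree = t} =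
      ((Finset.univ : Finset (Fin 3)).finsuppAntidiag t : Set (Fin 3 →₀ ℕ)) := by
    ext d
    simp [Finset.mem_finsuppAntidiag, Finsupp.degree_eq_sum]
  have h : Module.finrank K (restrictSupport K {d : Fin 3 →₀ ℕ | d.degree = t}) =
      (t + 2).choose 2 := by
    rw [Module.finrank_eq_nat_card_basis (basisRestrictSupport K _), hset]
    simp only [SetLike.coe_sort_coe, Nat.card_eq_fintype_card, Fintype.card_coe]
    rw [Finset.card_finsuppAntidiag_nat_eq_choose, Finset.card_univ, Fintype.card_fin,
      show 3 + t - 1 = t + 2 by omega, Nat.choose_symm_add]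
  rw [homogeneousSubmodule_eq_finsupp_supported]
  exact h

theorem hilbertScheme_add_hilbertIdeal (I : Ideal (MvPolynomial (Fin 3) K)) (t : ℕ) :
    hilbertScheme I t + hilbertIdeal I t = (t + 2).choose 2 := by
  rw [hilbertScheme, hilbertIdeal, Submodule.finrank_quotient_add_finrank,
    finrank_homogeneousSubmodule]

theorem hilbertIdeal_top (t : ℕ) :
    hilbertIdeal (⊤ : Ideal (MvPolynomial (Fin 3) K)) t = (t + 2).choose 2 := by
  have h : formsIn (⊤ : Ideal (MvPolynomial (Fin 3) K)) t = homogeneousSubmodule (Fin 3) K t :=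
    inf_eq_left.mpr fun _ _ => trivial
  rw [← finrank_formsIn, ← finrank_homogeneousSubmodule (K := K), h]

theorem hilbertIdeal_bot (t : ℕ) :
    hilbertIdeal (⊥ : Ideal (MvPolynomial (Fin 3) K)) t = 0 := by
  rw [← finrank_formsIn]
  have : formsIn (⊥ : Ideal (MvPolynomial (Fin 3) K)) t = ⊥ := by
    ext f
    simp only [mem_formsIn, Ideal.mem_bot, Submodule.mem_bot]
    exact ⟨fun h => h.2, fun h => ⟨h ▸ isHomogeneous_zero _ _ _, h⟩⟩
  rw [this, finrank_bot]

theorem isHomogeneous_colon_line {I : Ideal (MvPolynomial (Fin 3) K)}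
    (hI : I.IsHomogeneous (homogeneousSubmodule (Fin 3) K)) {F : MvPolynomial (Fin 3) K}
    (hF : IsLine F) :
    (Submodule.colon I {F}).IsHomogeneous (homogeneousSubmodule (Fin 3) K) := by
  intro i f hf
  rw [Submodule.mem_colon_singleton, smul_eq_mul, mul_comm] at hf ⊢
  rw [← DirectSum.coe_decompose_mul_add_of_left_mem (homogeneousSubmodule (Fin 3) K)
    (i := 1) (j := i) hF.1]
  exact hI _ hf

/-- The exact sequence `0 → (I : F)(-1) → I ⊕ R(-1) → I + (F) → 0` in degree `t + 1`. -/
theorem hilbertIdeal_sup_add_hilbertIdeal_colon {I : Ideal (MvPolynomial (Fin 3) K)}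
    (hI : I.IsHomogeneous (homogeneousSubmodule (Fin 3) K)) {F : MvPolynomial (Fin 3) K}
    (hF : IsLine F) (t : ℕ) :
    hilbertIdeal (I ⊔ Ideal.span {F}) (t + 1) + hilbertIdeal (Submodule.colon I {F}) t =
      hilbertIdeal I (t + 1) + (t + 2).choose 2 := by
  have hinj : Function.Injective (LinearMap.mulLeft K F) := fun a b h => by
    simpa [hF.2] using h
  have hsup : formsIn I (t + 1) ⊔ (homogeneousSubmodule (Fin 3) K t).map (LinearMap.mulLeft K F) =
      formsIn (I ⊔ Ideal.span {F}) (t + 1) := by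
    apply le_antisymm
    · refine sup_le ?_ ?_
      · exact fun f hf => ⟨hf.1, Ideal.mem_sup_left hf.2⟩
      · rintro _ ⟨g, hg, rfl⟩
        refine ⟨?_, Ideal.mem_sup_right (Ideal.mem_span_singleton.mpr ⟨g, rfl⟩)⟩
        rw [add_comm]
        exact hF.1.mul hg
    · rintro f ⟨hf, hfI⟩
      obtain ⟨a, ha, b, hb, rfl⟩ := Submodule.mem_sup.mp hfI
      obtain ⟨g, rfl⟩ := Ideal.mem_span_singleton.mp hb
      -- The sum is its own component of degree `t + 1`, so `a` and `g` may be replaced by theirs.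
      have h1 := DirectSum.decompose_of_mem_same (homogeneousSubmodule (Fin 3) K) hf
      have h2 := DirectSum.coe_decompose_mul_add_of_left_mem (homogeneousSubmodule (Fin 3) K)
        (i := 1) (j := t) (b := g) hF.1
      rw [add_comm 1 t] at h2
      rw [DirectSum.decompose_add, DirectSum.add_apply, Submodule.coe_add, h2] at h1
      rw [← h1]
      exact Submodule.add_mem_sup ⟨SetLike.coe_mem _, hI _ ha⟩ ⟨_, SetLike.coe_mem _, rfl⟩
  have hinf : formsIn I (t + 1) ⊓ (homogeneousSubmodule (Fin 3) K t).map (LinearMap.mulLeft K F) =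
      (formsIn (Submodule.colon I {F}) t).map (LinearMap.mulLeft K F) := by
    ext f
    constructor
    · rintro ⟨⟨-, hfI⟩, g, hg, rfl⟩
      exact ⟨g, ⟨hg, Submodule.mem_colon_singleton.mpr
        (by rw [smul_eq_mul, mul_comm]; exact hfI)⟩, rfl⟩
    · rintro ⟨g, ⟨hg, hgI⟩, rfl⟩
      refine ⟨⟨?_, ?_⟩, g, hg, rfl⟩
      · rw [add_comm]
        exact hF.1.mul hg
      · have := Submodule.mem_colon_singleton.mp hgI
        rwa [smul_eq_mul, mul_comm] at this
  have h := Submodule.finrank_sup_add_finrank_inf_eq (formsIn I (t + 1))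
    ((homogeneousSubmodule (Fin 3) K t).map (LinearMap.mulLeft K F))
  rwa [hsup, hinf, ← (Submodule.equivMapOfInjective _ hinj _).finrank_eq,
    ← (Submodule.equivMapOfInjective _ hinj _).finrank_eq, finrank_homogeneousSubmodule,
    finrank_formsIn, finrank_formsIn, finrank_formsIn] at h

/-- A line has no equation in degree `0`, so adding its equation changes nothing there. -/
theorem hilbertIdeal_sup_zero {I : Ideal (MvPolynomial (Fin 3) K)}
    (hI : I.IsHomogeneous (homogeneousSubmodule (Fin 3) K)) {F : MvPolynomial (Fin 3) K}
    (hF : IsLine F) : hilbertIdeal (I ⊔ Ideal.span {F}) 0 = hilbertIdeal I 0 := by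
  rw [← finrank_formsIn, ← finrank_formsIn]
  suffices h : formsIn (I ⊔ Ideal.span {F}) 0 = formsIn I 0 by rw [h]
  apply le_antisymm
  · rintro f ⟨hf, hfI⟩
    obtain ⟨a, ha, b, hb, rfl⟩ := Submodule.mem_sup.mp hfI
    obtain ⟨g, rfl⟩ := Ideal.mem_span_singleton.mp hb
    have h1 := DirectSum.decompose_of_mem_same (homogeneousSubmodule (Fin 3) K) hf
    have h2 := DirectSum.coe_decompose_mul_of_left_mem_of_not_le (homogeneousSubmodule (Fin 3) K)
      (i := 1) (n := 0) (b := g) hF.1 (by simp)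
    rw [DirectSum.decompose_add, DirectSum.add_apply, Submodule.coe_add, h2, add_zero] at h1
    rw [← h1]
    exact ⟨SetLike.coe_mem _, hI _ ha⟩
  · exact fun f hf => ⟨hf.1, Ideal.mem_sup_left hf.2⟩

theorem colon_line_bot {F : MvPolynomial (Fin 3) K} (hF : IsLine F) :
    Submodule.colon (⊥ : Ideal (MvPolynomial (Fin 3) K)) {F} = ⊥ := by
  ext f
  simp [Submodule.mem_colon_singleton, hF.2]

theorem hilbertIdeal_span_line {F : MvPolynomial (Fin 3) K} (hF : IsLine F) (t : ℕ) :
    hilbertIdeal (Ideal.span {F}) t = (t + 1).choose 2 := by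
  have hbot := Ideal.IsHomogeneous.bot (homogeneousSubmodule (Fin 3) K)
  cases t with
  | zero =>
    have := hilbertIdeal_sup_zero hbot hF
    rw [bot_sup_eq] at this
    simp [this, hilbertIdeal_bot]
  | succ t =>
    have := hilbertIdeal_sup_add_hilbertIdeal_colon hbot hF t
    rwa [colon_line_bot hF, hilbertIdeal_bot, hilbertIdeal_bot, bot_sup_eq, add_zero,
      zero_add] at this

/-- The exact sequence `0 → (R / (I : F))(-1) → R / I → R / (I + (F)) → 0` in degree `t + 1`. -/
theorem hilbertScheme_succ {I : Ideal (MvPolynomial (Fin 3) K)}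
    (hI : I.IsHomogeneous (homogeneousSubmodule (Fin 3) K)) {F : MvPolynomial (Fin 3) K}
    (hF : IsLine F) (t : ℕ) :
    hilbertScheme I (t + 1) =
      hilbertScheme (Submodule.colon I {F}) t + hilbertScheme (I ⊔ Ideal.span {F}) (t + 1) := by
  have h1 := hilbertIdeal_sup_add_hilbertIdeal_colon hI hF t
  have h2 := hilbertScheme_add_hilbertIdeal I (t + 1)
  have h3 := hilbertScheme_add_hilbertIdeal (Submodule.colon I {F}) t
  have h4 := hilbertScheme_add_hilbertIdeal (I ⊔ Ideal.span {F}) (t + 1)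
  omega

end HilbertFunctions

/-! ### Subschemes of a line -/

section Line

variable {K : Type*} [Field K]

theorem IsLine.prime {F : MvPolynomial (Fin 3) K} (hF : IsLine F) : Prime F := by
  refine (irreducible_of_totalDegree_eq_one (hF.1.totalDegree hF.2) fun x hx => ?_).prime
  obtain ⟨i, hi⟩ := MvPolynomial.ne_zero_iff.mp hF.2
  exact (ne_zero_of_dvd_ne_zero hi (hx i)).isUnit

/-- A nonzero space of elements of a domain grows in dimension when it is multiplied by two linearly
independent elements `x`, `y`: otherwise multiplication by `y / x` would be an endomorphism of it,
and would have an eigenvector. -/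
theorem finrank_lt_of_mul_mem [IsAlgClosed K] {S : Type*} [CommRing S] [IsDomain S] [Algebra K S]
    {V W : Submodule K S} [Module.Finite K V] [Module.Finite K W] (hV : V ≠ ⊥) {x y : S}
    (hxy : LinearIndependent K ![x, y]) (hx : ∀ v ∈ V, x * v ∈ W) (hy : ∀ v ∈ V, y * v ∈ W) :
    Module.finrank K V < Module.finrank K W := by
  by_contra! hle
  have hx0 : x ≠ 0 := hxy.ne_zero 0
  let φ : V →ₗ[K] W := (LinearMap.mulLeft K x).restrict hx
  let ψ : V →ₗ[K] W := (LinearMap.mulLeft K y).restrict hy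
  have hφ : Function.Injective φ := fun a b h => by
    have : x * (a : S) = x * b := congrArg Subtype.val h
    exact Subtype.ext (mul_left_cancel₀ hx0 this)
  have heq := le_antisymm (LinearMap.finrank_le_finrank_of_injective hφ) hle
  let e := LinearMap.linearEquivOfInjective φ hφ heq
  have : Nontrivial V := Submodule.nontrivial_iff_ne_bot.mpr hV
  obtain ⟨c, hc⟩ := Module.End.exists_eigenvalue (e.symm.toLinearMap ∘ₗ ψ : Module.End K V)
  obtain ⟨v, hv⟩ := hc.exists_hasEigenvector
  have h1 : ψ v = e (c • v) := by
    rw [← hv.apply_eq_smul]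
    simp
  have h2 : y * (v : S) = x * (c • (v : S)) := congrArg Subtype.val h1
  have h3 : ((-c) • x + (1 : K) • y) * (v : S) = 0 := by
    rw [add_mul, one_smul, h2]
    simp
  rcases mul_eq_zero.mp h3 with h | h
  · exact one_ne_zero (LinearIndependent.pair_iff.mp hxy _ _ h).2
  · exact hv.2 (Subtype.ext h)

/-- The forms of degree `t` in `J ∋ F`, restricted to the line `F = 0`. -/
noncomputable def restrictForms (F : MvPolynomial (Fin 3) K) (J : Ideal (MvPolynomial (Fin 3) K))
    (t : ℕ) : Submodule K (MvPolynomial (Fin 3) K ⧸ Ideal.span {F}) :=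
  (formsIn J t).map (Ideal.Quotient.mkₐ K (Ideal.span {F})).toLinearMap

instance finite_restrictForms (F : MvPolynomial (Fin 3) K) (J : Ideal (MvPolynomial (Fin 3) K))
    (t : ℕ) : Module.Finite K (restrictForms F J t) :=
  Module.Finite.map _ _

theorem finrank_restrictForms_add {F : MvPolynomial (Fin 3) K} (hF : IsLine F)
    {J : Ideal (MvPolynomial (Fin 3) K)} (hJ : F ∈ J) (t : ℕ) :
    Module.finrank K (restrictForms F J t) + (t + 1).choose 2 = hilbertIdeal J t := by
  have h := LinearMap.finrank_range_add_finrank_ker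
    ((Ideal.Quotient.mkₐ K (Ideal.span {F})).toLinearMap.domRestrict (formsIn J t))
  have hker : LinearMap.ker
      ((Ideal.Quotient.mkₐ K (Ideal.span {F})).toLinearMap.domRestrict (formsIn J t)) =
      (formsIn (Ideal.span {F}) t).comap (formsIn J t).subtype := by
    ext f
    simp only [LinearMap.mem_ker, LinearMap.domRestrict_apply, AlgHom.toLinearMap_apply,
      Ideal.Quotient.mkₐ_eq_mk, Ideal.Quotient.eq_zero_iff_mem, Submodule.mem_comap,
      Submodule.subtype_apply, mem_formsIn]
    exact ⟨fun h => ⟨f.2.1, h⟩, fun h => h.2⟩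
  have hle : formsIn (Ideal.span {F}) t ≤ formsIn J t := fun f hf =>
    ⟨hf.1, (Ideal.span_singleton_le_iff_mem J).mpr hJ hf.2⟩
  rw [hker, (Submodule.comapSubtypeEquivOfLe hle).finrank_eq, LinearMap.range_domRestrict,
    finrank_formsIn, finrank_formsIn, hilbertIdeal_span_line hF] at h
  exact h

theorem choose_two_succ (t : ℕ) : (t + 2).choose 2 = (t + 1).choose 2 + (t + 1) := by
  rw [Nat.choose_succ_succ' (t + 1) 1, Nat.choose_one_right, add_comm]

/-- For a subscheme of a line, the Hilbert function does not increase from degree `t` to `t + 1`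
once some form of degree `t`, not divisible by the equation of the line, contains the subscheme. -/
theorem hilbertScheme_succ_le_of_lt [IsAlgClosed K] {F : MvPolynomial (Fin 3) K} (hF : IsLine F)
    {J : Ideal (MvPolynomial (Fin 3) K)} (hJ : F ∈ J) {t : ℕ} (ht : hilbertScheme J t < t + 1) :
    hilbertScheme J (t + 1) ≤ hilbertScheme J t := by
  have hprime : (Ideal.span {F}).IsPrime := (Ideal.span_singleton_prime hF.2).mpr hF.prime
  have h0 := finrank_restrictForms_add hF hJ t
  have h1 := finrank_restrictForms_add hF hJ (t + 1)
  have h2 := hilbertScheme_add_hilbertIdeal J t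
  have h3 := hilbertScheme_add_hilbertIdeal J (t + 1)
  have h4 := choose_two_succ t
  have h5 := choose_two_succ (t + 1)
  have hV : restrictForms F J t ≠ ⊥ := by
    intro h
    rw [h, finrank_bot] at h0
    omega
  have hlin := finrank_restrictForms_add hF (J := ⊤) trivial 1
  rw [hilbertIdeal_top] at hlin
  have hlin2 : Module.finrank K (restrictForms F ⊤ 1) = 2 := by
    have : Nat.choose 2 2 = 1 ∧ Nat.choose 3 2 = 3 := by decide
    norm_num [this.2] at hlin
    omega
  have : Nontrivial (restrictForms F ⊤ 1) := Module.nontrivial_of_finrank_pos (R := K) (by omega)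
  obtain ⟨x, hx⟩ := exists_ne (0 : restrictForms F ⊤ 1)
  obtain ⟨y, hxy⟩ := exists_linearIndependent_pair_of_one_lt_finrank (R := K) (by omega) hx
  have hxy' : LinearIndependent K ![(x : MvPolynomial (Fin 3) K ⧸ Ideal.span {F}), y] :=
    LinearIndependent.pair_iff.mpr fun a b h =>
      LinearIndependent.pair_iff.mp hxy a b (Subtype.ext h)
  have hmul : ∀ z : restrictForms F ⊤ 1, ∀ v ∈ restrictForms F J t,
      (z : MvPolynomial (Fin 3) K ⧸ Ideal.span {F}) * v ∈ restrictForms F J (t + 1) := by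
    rintro ⟨_, g, hg, rfl⟩ _ ⟨f, hf, rfl⟩
    refine ⟨g * f, ⟨?_, J.mul_mem_left g hf.2⟩, map_mul (Ideal.Quotient.mkₐ K _) g f⟩
    rw [add_comm]
    exact hg.1.mul hf.1
  have := finrank_lt_of_mul_mem hV hxy' (hmul x) (hmul y)
  omega

/-- A subscheme of degree `d` of a line imposes at least `min (t + 1) d` conditions on forms of
degree `t`. -/
theorem min_le_hilbertScheme [IsAlgClosed K] {F : MvPolynomial (Fin 3) K} (hF : IsLine F)
    {J : Ideal (MvPolynomial (Fin 3) K)} (hJ : F ∈ J) {d : ℤ} (hd : HasDegree J d) (t : ℕ) :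
    min ((t : ℤ) + 1) d ≤ hilbertScheme J t := by
  by_cases ht : hilbertScheme J t < t + 1
  · have hanti : ∀ s, t ≤ s → hilbertScheme J s ≤ hilbertScheme J t := by
      intro s hs
      induction s, hs using Nat.le_induction with
      | base => exact le_rfl
      | succ s hs ih => exact (hilbertScheme_succ_le_of_lt hF hJ (by omega)).trans ih
    obtain ⟨s, hs, hst⟩ := (hd.and (Filter.eventually_ge_atTop t)).exists
    have := hanti s hst
    omega
  · omega

end Line

/-! ### Powers of the ideal of a point -/

section Points

variable {K : Type*} [Field K]

attribute [local instance] MvPolynomial.gradedAlgebra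

theorem isHomogeneous_pointIdeal_pow (p : Projectivization K (Fin 3 → K)) (m : ℕ) :
    (pointIdeal p ^ m).IsHomogeneous (homogeneousSubmodule (Fin 3) K) := by
  induction m with
  | zero =>
    rw [pow_zero, Ideal.one_eq_top]
    exact Ideal.IsHomogeneous.top _
  | succ m ih =>
    rw [pow_succ]
    exact ih.mul (Ideal.homogeneous_span _ _ fun f hf => hf.1)

theorem isHomogeneous_fatPointIdeal {r : ℕ} (p : Fin r → Projectivization K (Fin 3 → K))
    (m : Fin r → ℕ) : (fatPointIdeal p m).IsHomogeneous (homogeneousSubmodule (Fin 3) K) :=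
  Ideal.IsHomogeneous.iInf fun i => isHomogeneous_pointIdeal_pow (p i) (m i)

theorem aeval_mul_of_isHomogeneous {S : Type*} [CommRing S] [Algebra K S] (v : Fin 3 → K) (s : S)
    {f : MvPolynomial (Fin 3) K} {e : ℕ} (hf : f.IsHomogeneous e) :
    aeval (fun i => algebraMap K S (v i) * s) f = algebraMap K S (eval v f) * s ^ e := by
  rw [aeval_def, eval₂_eq', eval_eq', map_sum, Finset.sum_mul]
  refine Finset.sum_congr rfl fun c hc => ?_
  have hdeg : c 0 + c 1 + c 2 = e := by
    rw [hf.degree_eq_sum_deg_support hc, ← Finsupp.degree_apply, Finsupp.degree_eq_sum,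
      Fin.sum_univ_three]
  rw [← hdeg]
  simp only [Fin.prod_univ_three, map_mul, map_pow]
  ring

section Deformation

variable (p : Projectivization K (Fin 3 → K)) (l : MvPolynomial (Fin 3) K)

/-- For a linear form `l` with value `1` at the representative `v` of `p`, the deformation
`x_i = v_i l + (x_i - v_i l) ↦ v_i l + T (x_i - v_i l)` of the identity, which contracts the plane
to `p`. The order of vanishing at `p` becomes the order of vanishing at `T = 0`. -/
noncomputable def contraction : MvPolynomial (Fin 3) K →ₐ[K] Polynomial (MvPolynomial (Fin 3) K) :=
  aeval fun i => Polynomial.C (C (p.rep i) * l) +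
    Polynomial.X * Polynomial.C (X i - C (p.rep i) * l)

variable {p l}

theorem contraction_of_linear {f : MvPolynomial (Fin 3) K} (hf : f.IsHomogeneous 1) :
    contraction p l f = Polynomial.C (C (eval p.rep f) * l) +
      Polynomial.X * Polynomial.C (f - C (eval p.rep f) * l) := by
  have hf' : f ∈ Submodule.span K (Set.range (X : Fin 3 → MvPolynomial (Fin 3) K)) := by
    rw [← homogeneousSubmodule_one_eq_span_X]
    exact hf
  clear hf
  induction hf' using Submodule.span_induction with
  | mem x hx =>
    obtain ⟨i, rfl⟩ := hx
    simp [contraction]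
  | zero => simp
  | add x y _ _ hx hy =>
    simp only [map_add, hx, hy, map_sub, map_mul]
    ring
  | smul a x _ hx =>
    simp only [MvPolynomial.smul_eq_C_mul, map_mul, hx, map_sub, eval_C]
    rw [show contraction p l (C a) = Polynomial.C (C a) from (contraction p l).commutes a]
    ring

theorem contraction_self (hl : l.IsHomogeneous 1) (h1 : eval p.rep l = 1) :
    contraction p l l = Polynomial.C l := by
  simp [contraction_of_linear hl, h1]

theorem eval_zero_contraction {f : MvPolynomial (Fin 3) K} {e : ℕ} (hf : f.IsHomogeneous e) :
    (contraction p l f).eval 0 = C (eval p.rep f) * l ^ e := by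
  rw [← Polynomial.coe_aeval_eq_eval]
  have : ((Polynomial.aeval (0 : MvPolynomial (Fin 3) K)).restrictScalars K).comp
      (contraction p l) = aeval fun i => algebraMap K (MvPolynomial (Fin 3) K) (p.rep i) * l := by
    ext i
    simp [contraction, MvPolynomial.algebraMap_eq]
  have h := DFunLike.congr_fun this f
  rw [aeval_mul_of_isHomogeneous _ _ hf] at h
  exact h

theorem eval_one_contraction (f : MvPolynomial (Fin 3) K) : (contraction p l f).eval 1 = f := by
  rw [← Polynomial.coe_aeval_eq_eval]
  have : ((Polynomial.aeval (1 : MvPolynomial (Fin 3) K)).restrictScalars K).comp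
      (contraction p l) = AlgHom.id K _ := by
    ext i
    simp [contraction]
  exact DFunLike.congr_fun this f

/-- The coefficient of `T ^ k` in the contraction lies in `I_p ^ k`. -/
theorem contraction_mem_reesAlgebra (hl : l.IsHomogeneous 1) (h1 : eval p.rep l = 1)
    (f : MvPolynomial (Fin 3) K) : contraction p l f ∈ reesAlgebra (pointIdeal p) := by
  induction f using MvPolynomial.induction_on with
  | C a =>
    rw [show contraction p l (C a) = Polynomial.C (C a) from (contraction p l).commutes a]
    exact (reesAlgebra (pointIdeal p)).algebraMap_mem (C a)
  | add f g hf hg =>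
    rw [map_add]
    exact add_mem hf hg
  | mul_X f i hf =>
    rw [map_mul]
    refine mul_mem hf ?_
    rw [contraction_of_linear (isHomogeneous_X K i)]
    refine add_mem ((reesAlgebra (pointIdeal p)).algebraMap_mem _) ?_
    rw [mul_comm, ← pow_one Polynomial.X, Polynomial.C_mul_X_pow_eq_monomial,
      reesAlgebra.monomial_mem, pow_one]
    refine Ideal.subset_span ⟨⟨1, (isHomogeneous_X K i).sub (hl.C_mul _)⟩, ?_⟩
    simp [h1]

theorem mem_pointIdeal_pow_iff (hl : l.IsHomogeneous 1) (h1 : eval p.rep l = 1) (m : ℕ)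
    (f : MvPolynomial (Fin 3) K) :
    f ∈ pointIdeal p ^ m ↔ Polynomial.X ^ m ∣ contraction p l f := by
  constructor
  · intro hf
    have hle : pointIdeal p ≤ (Ideal.span {Polynomial.X}).comap (contraction p l).toRingHom := by
      refine Ideal.span_le.mpr ?_
      rintro g ⟨⟨e, he⟩, hg⟩
      refine Ideal.mem_span_singleton.mpr (Polynomial.X_dvd_iff.mpr ?_)
      rw [Polynomial.coeff_zero_eq_eval_zero]
      exact (eval_zero_contraction he).trans (by simp [hg])
    have h2 := (Ideal.pow_right_mono hle m).trans (Ideal.le_comap_pow _ m) hf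
    rw [Ideal.mem_comap, Ideal.span_singleton_pow, Ideal.mem_span_singleton] at h2
    exact h2
  · intro h
    rw [← eval_one_contraction (p := p) (l := l) f, Polynomial.eval_eq_sum, Polynomial.sum]
    refine Ideal.sum_mem _ fun k _ => ?_
    rw [one_pow, mul_one]
    by_cases hk : k < m
    · rw [Polynomial.X_pow_dvd_iff.mp h k hk]
      exact Ideal.zero_mem _
    · exact Ideal.pow_le_pow_right (not_lt.mp hk) (contraction_mem_reesAlgebra hl h1 f k)

end Deformation

/-- The powers of `I_p` are `I_p`-primary, tested on linear forms. -/
theorem mem_pointIdeal_pow_of_mul_mem {p : Projectivization K (Fin 3 → K)}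
    {l : MvPolynomial (Fin 3) K} (hl : l.IsHomogeneous 1) (hp : eval p.rep l ≠ 0) {m : ℕ}
    {f : MvPolynomial (Fin 3) K} (hf : l * f ∈ pointIdeal p ^ m) : f ∈ pointIdeal p ^ m := by
  set l' := C (eval p.rep l)⁻¹ * l with hl'
  have h1 : eval p.rep l' = 1 := by simp [hl', hp]
  have hlin : l'.IsHomogeneous 1 := hl.C_mul _
  have hl0 : l' ≠ 0 := fun h => by simp [h] at h1
  have hf' : l' * f ∈ pointIdeal p ^ m := by
    rw [hl', mul_assoc]
    exact Ideal.mul_mem_left _ _ hf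
  rw [mem_pointIdeal_pow_iff hlin h1, map_mul, contraction_self hlin h1,
    Polynomial.X_pow_dvd_iff] at hf'
  rw [mem_pointIdeal_pow_iff hlin h1, Polynomial.X_pow_dvd_iff]
  intro k hk
  have := hf' k hk
  rw [Polynomial.coeff_C_mul] at this
  exact (mul_eq_zero.mp this).resolve_left hl0

theorem exists_line_forall_eval_ne_zero [Infinite K] {r : ℕ}
    (p : Fin r → Projectivization K (Fin 3 → K)) :
    ∃ l : MvPolynomial (Fin 3) K, IsLine l ∧ ∀ i, eval (p i).rep l ≠ 0 := by
  -- The additional vector `1` ensures `l ≠ 0` even when there are no points.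
  obtain ⟨φ, hφ⟩ := Module.exists_dual_forall_apply_ne_zero (K := K)
    (fun o : Option (Fin r) => o.elim (fun _ => (1 : K)) fun i => (p i).rep)
    (by
      rintro (_ | i)
      · exact one_ne_zero
      · exact (p i).rep_nonzero)
  have hev : ∀ v, eval v (∑ i, C (φ fun j => if i = j then 1 else 0) * X i) = φ v := fun v => by
    rw [LinearMap.pi_apply_eq_sum_univ φ v]
    simp [mul_comm]
  refine ⟨∑ i, C (φ fun j => if i = j then 1 else 0) * X i, ⟨IsHomogeneous.sum _ _ _ fun i _ =>
    isHomogeneous_C_mul_X _ _, fun h => hφ none ?_⟩, fun i => ?_⟩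
  · rw [← hev, h, map_zero]
  · rw [hev]
    exact hφ (some i)

end Points

/-! ### Telescoping tail sums -/

section TailSums

theorem sum_tail_castSucc {N : ℕ} (f : Fin N → ℤ) (i : Fin N) :
    ∑ j ∈ Finset.univ.filter (fun j : Fin N => (i.castSucc : ℕ) ≤ j), f j =
      f i + ∑ j ∈ Finset.univ.filter (fun j : Fin N => (i.succ : ℕ) ≤ j), f j := by
  rw [← Finset.sum_insert (by simp)]
  congr 1
  ext j
  simp only [Finset.mem_filter, Finset.mem_univ, true_and, Finset.mem_insert, Fin.ext_iff,
    Fin.val_castSucc, Fin.val_succ]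
  omega

theorem sum_tail_last {N : ℕ} (f : Fin N → ℤ) :
    ∑ j ∈ Finset.univ.filter (fun j : Fin N => (Fin.last N : ℕ) ≤ j), f j = 0 :=
  Finset.sum_eq_zero fun j hj => by
    have := (Finset.mem_filter.mp hj).2
    rw [Fin.val_last] at this
    omega

theorem sum_tail_telescope {N : ℕ} (a : Fin (N + 1) → ℤ) (i : Fin (N + 1)) :
    ∑ j ∈ Finset.univ.filter (fun j : Fin N => (i : ℕ) ≤ j), (a j.castSucc - a j.succ) =
      a i - a (Fin.last N) := by
  induction i using Fin.reverseInduction with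
  | last => rw [sum_tail_last, sub_self]
  | cast i ih => rw [sum_tail_castSucc, ih]; ring

theorem sum_telescope {N : ℕ} (a : Fin (N + 1) → ℤ) :
    ∑ j : Fin N, (a j.castSucc - a j.succ) = a 0 - a (Fin.last N) := by
  rw [← sum_tail_telescope a 0]
  simp

end TailSums

/-! ### The two bounds agree for GMS vectors -/

section Bounds

theorem binom_one (a : ℤ) : binom a 1 = max a 0 := by
  rw [binom, Nat.choose_one_right]
  exact Int.ofNat_toNat a

theorem binom_two_sub (s : ℤ) : binom (s + 2) 2 - binom (s + 1) 2 = max (s + 1) 0 := by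
  rcases le_or_gt 0 s with h | h
  · obtain ⟨k, rfl⟩ := Int.eq_ofNat_of_zero_le h
    have h1 : ((k : ℤ) + 2).toNat = k + 2 := by omega
    have h2 : ((k : ℤ) + 1).toNat = k + 1 := by omega
    rw [binom, binom, h1, h2, choose_two_succ]
    push_cast
    omega
  · have h1 : (s + 2).toNat < 2 := by omega
    have h2 : (s + 1).toNat < 2 := by omega
    rw [binom, binom, Nat.choose_eq_zero_of_lt h1, Nat.choose_eq_zero_of_lt h2]
    omega

theorem binom_eq_add_sum_tail {n : ℕ} (t : ℤ) (i : Fin (n + 2)) :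
    binom (t - (i : ℤ) + 2) 2 = binom (t - (n : ℤ) + 1) 2 +
      ∑ j ∈ Finset.univ.filter (fun j : Fin (n + 1) => (i : ℕ) ≤ (j : ℕ)),
        max (t - (j : ℤ) + 1) 0 := by
  have h := sum_tail_telescope (fun j : Fin (n + 2) => binom (t - (j : ℤ) + 2) 2) i
  have h2 : ∀ j : Fin (n + 1), max (t - (j : ℤ) + 1) 0 =
      binom (t - ((j.castSucc : ℕ) : ℤ) + 2) 2 - binom (t - ((j.succ : ℕ) : ℤ) + 2) 2 := fun j => by
    rw [← binom_two_sub, Fin.val_castSucc, Fin.val_succ]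
    push_cast
    ring_nf
  simp only [h2, h, Fin.val_last]
  push_cast
  ring_nf

theorem lowerTerm_eq {n : ℕ} (d : Fin (n + 1) → ℤ) (t : ℤ) (i : Fin (n + 2)) :
    lowerTerm d t i = binom (t - (n : ℤ) + 1) 2 +
      ∑ j ∈ Finset.univ.filter (fun j : Fin (n + 1) => (i : ℕ) ≤ (j : ℕ)),
        (max (t - (j : ℤ) + 1) 0 - d j) := by
  rw [lowerTerm, binom_eq_add_sum_tail, Finset.sum_sub_distrib]
  ring

theorem lowerTerm_le_upperBound {n : ℕ} {d : Fin (n + 1) → ℤ} (hd : ∀ i, 0 ≤ d i) (t : ℤ)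
    (i : Fin (n + 2)) : lowerTerm d t i ≤ upperBound d t := by
  rw [lowerTerm_eq, upperBound]
  simp only [binom_one]
  refine add_le_add le_rfl ((Finset.sum_le_sum fun j _ => ?_).trans
    (Finset.sum_le_sum_of_subset_of_nonneg (Finset.filter_subset _ _) fun j _ _ =>
      le_max_right _ _))
  have := hd j
  omega

/-- If `d` is GMS, then the bounds agree at the first index `i` with `d i + i ≤ t`: the GMS
inequalities give `d j + j ≤ t + 1` for all later `j`. -/
theorem exists_upperBound_le_lowerTerm {n : ℕ} {d : Fin (n + 1) → ℤ} (hd : IsGMS d) (t : ℤ) :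
    ∃ i, upperBound d t ≤ lowerTerm d t i := by
  suffices h : ∃ i : Fin (n + 2), (∀ j : Fin (n + 1), (i : ℕ) ≤ j → d j + j ≤ t + 1) ∧
      ∀ j : Fin (n + 1), (j : ℕ) < i → t + 1 ≤ d j + j by
    obtain ⟨i, h1, h2⟩ := h
    refine ⟨i, ?_⟩
    rw [lowerTerm_eq, upperBound, Finset.sum_filter]
    simp only [binom_one]
    refine add_le_add le_rfl (Finset.sum_le_sum fun j _ => ?_)
    have h0 := hd.1 j
    split_ifs with hij
    · have := h1 j hij
      omega
    · have := h2 j (not_le.mp hij)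
      omega
  by_cases hex : ∃ k, ∃ hk : k < n + 1, d ⟨k, hk⟩ + k ≤ t
  · obtain ⟨k, ⟨hk, hkt⟩, hmin⟩ : ∃ k, (∃ hk : k < n + 1, d ⟨k, hk⟩ + k ≤ t) ∧
        ∀ j < k, ¬ ∃ hj : j < n + 1, d ⟨j, hj⟩ + j ≤ t :=
      ⟨Nat.find hex, Nat.find_spec hex, fun _ => Nat.find_min hex⟩
    refine ⟨⟨k, by omega⟩, fun j hj => ?_, fun j hj => ?_⟩
    · rcases hj.eq_or_lt with h | h
      · have : j = ⟨k, hk⟩ := Fin.ext h.symm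
        subst this
        dsimp only
        omega
      · have := hd.2.2 ⟨k, hk⟩ j h
        dsimp only at this
        omega
    · by_contra! hlt
      exact hmin j hj ⟨j.2, by dsimp only [Fin.eta]; omega⟩
  · push Not at hex
    refine ⟨Fin.last (n + 1), fun j hj => ?_, fun j _ => ?_⟩
    · rw [Fin.val_last] at hj
      omega
    · have := hex j j.2
      dsimp only [Fin.eta] at this
      omega

theorem lowerBound_eq_upperBound {n : ℕ} {d : Fin (n + 1) → ℤ} (hd : IsGMS d) (t : ℤ) :
    lowerBound d t = upperBound d t := by
  obtain ⟨i, hi⟩ := exists_upperBound_le_lowerTerm hd t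
  exact le_antisymm (Finset.sup'_le _ _ fun i _ => lowerTerm_le_upperBound hd.1 t i)
    (hi.trans (Finset.le_sup' (lowerTerm d t) (Finset.mem_univ i)))

end Bounds

/-! ### Hilbert functions along a sequence of residuals -/

section Reduction

variable {K : Type*} [Field K]

attribute [local instance] MvPolynomial.gradedAlgebra

theorem residualIdeal_succ (I : Ideal (MvPolynomial (Fin 3) K)) {N : ℕ}
    (F : Fin N → MvPolynomial (Fin 3) K) (j : Fin N) :
    residualIdeal I F j.succ = Submodule.colon (residualIdeal I F j.castSucc) {F j} :=
  Fin.induction_succ _ _ _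

theorem isHomogeneous_residualIdeal {I : Ideal (MvPolynomial (Fin 3) K)}
    (hI : I.IsHomogeneous (homogeneousSubmodule (Fin 3) K)) {N : ℕ}
    {F : Fin N → MvPolynomial (Fin 3) K} (hF : ∀ j, IsLine (F j)) (i : Fin (N + 1)) :
    (residualIdeal I F i).IsHomogeneous (homogeneousSubmodule (Fin 3) K) := by
  induction i using Fin.induction with
  | zero => exact hI
  | succ j ih =>
    rw [residualIdeal_succ]
    exact isHomogeneous_colon_line ih (hF j)

/-- A linear form missing all the points is not a zero divisor modulo any of the residuals. -/
theorem colon_residualIdeal_fatPointIdeal {r : ℕ} {p : Fin r → Projectivization K (Fin 3 → K)}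
    (m : Fin r → ℕ) {l : MvPolynomial (Fin 3) K} (hl : IsLine l)
    (hp : ∀ i, eval (p i).rep l ≠ 0) {N : ℕ} (F : Fin N → MvPolynomial (Fin 3) K)
    (i : Fin (N + 1)) :
    Submodule.colon (residualIdeal (fatPointIdeal p m) F i) {l} =
      residualIdeal (fatPointIdeal p m) F i := by
  refine le_antisymm ?_ Ideal.le_colon
  intro f hf
  rw [Submodule.mem_colon_singleton, smul_eq_mul, mul_comm] at hf
  induction i using Fin.induction generalizing f with
  | zero =>
    refine Ideal.mem_iInf.mpr fun k => ?_
    exact mem_pointIdeal_pow_of_mul_mem hl.1 (hp k) (Ideal.mem_iInf.mp hf k)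
  | succ j ih =>
    rw [residualIdeal_succ, Submodule.mem_colon_singleton, smul_eq_mul] at hf ⊢
    exact ih (by rwa [← mul_assoc])

/-- The Hilbert function of a scheme does not decrease if some line misses the scheme. -/
theorem hilbertScheme_mono {I : Ideal (MvPolynomial (Fin 3) K)}
    (hI : I.IsHomogeneous (homogeneousSubmodule (Fin 3) K)) {l : MvPolynomial (Fin 3) K}
    (hl : IsLine l) (hIl : Submodule.colon I {l} = I) : Monotone (hilbertScheme I) :=
  monotone_nat_of_le_succ fun t => by
    rw [hilbertScheme_succ hI hl, hIl]
    exact Nat.le_add_right _ _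

/-- Degrees add up along a totally reducing sequence of lines. -/
theorem hasDegree_residualIdeal {I : Ideal (MvPolynomial (Fin 3) K)}
    (hI : I.IsHomogeneous (homogeneousSubmodule (Fin 3) K)) {N : ℕ}
    {F : Fin N → MvPolynomial (Fin 3) K} (hF : ∀ j, IsLine (F j)) (hred : TotallyReduces I F)
    {d : Fin N → ℤ} (hd : IsReductionVector I F d) (i : Fin (N + 1)) :
    HasDegree (residualIdeal I F i)
      (∑ j ∈ Finset.univ.filter (fun j : Fin N => (i : ℕ) ≤ (j : ℕ)), d j) := by
  induction i using Fin.reverseInduction with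
  | last =>
    rw [sum_tail_last, hred]
    refine Filter.Eventually.of_forall fun t => ?_
    have h1 := hilbertScheme_add_hilbertIdeal (⊤ : Ideal (MvPolynomial (Fin 3) K)) t
    have h2 := hilbertIdeal_top (K := K) t
    omega
  | cast j ih =>
    rw [sum_tail_castSucc]
    rw [residualIdeal_succ] at ih
    obtain ⟨a, ha⟩ := Filter.eventually_atTop.mp ih
    obtain ⟨b, hb⟩ := Filter.eventually_atTop.mp (hd j)
    refine Filter.eventually_atTop.mpr ⟨max a b + 1, fun t ht => ?_⟩
    obtain ⟨s, rfl⟩ : ∃ s, t = s + 1 := ⟨t - 1, by omega⟩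
    rw [hilbertScheme_succ (isHomogeneous_residualIdeal hI hF _) (hF j), Nat.cast_add,
      ha s (by omega), hb (s + 1) (by omega), add_comm]

/-- The Hilbert function of an ideal, extended by zero to negative degrees. -/
noncomputable def hilbertInt (I : Ideal (MvPolynomial (Fin 3) K)) (t : ℤ) : ℤ :=
  if 0 ≤ t then (hilbertIdeal I t.toNat : ℤ) else 0

theorem hilbertInt_natCast (I : Ideal (MvPolynomial (Fin 3) K)) (t : ℕ) :
    hilbertInt I t = hilbertIdeal I t := by
  simp [hilbertInt]

theorem hilbertInt_of_neg (I : Ideal (MvPolynomial (Fin 3) K)) {t : ℤ} (ht : t < 0) :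
    hilbertInt I t = 0 :=
  if_neg (not_le.mpr ht)

theorem hilbertInt_nonneg (I : Ideal (MvPolynomial (Fin 3) K)) (t : ℤ) : 0 ≤ hilbertInt I t := by
  unfold hilbertInt
  split_ifs <;> positivity

theorem hilbertInt_top (t : ℤ) :
    hilbertInt (⊤ : Ideal (MvPolynomial (Fin 3) K)) t = binom (t + 2) 2 := by
  rcases le_or_gt 0 t with h | h
  · obtain ⟨k, rfl⟩ := Int.eq_ofNat_of_zero_le h
    rw [hilbertInt_natCast, hilbertIdeal_top, binom]
    congr 2
  · rw [hilbertInt_of_neg _ h, binom, Nat.choose_eq_zero_of_lt (by omega), Nat.cast_zero]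

theorem binom_natCast_add_two (t : ℕ) : binom ((t : ℤ) + 2) 2 = ((t + 2).choose 2 : ℕ) := rfl

/-- Multiplication by `F` embeds the forms of degree `t - 1` in `I : F` into those of degree `t`
in `I`. -/
theorem hilbertInt_colon_le {I : Ideal (MvPolynomial (Fin 3) K)}
    (hI : I.IsHomogeneous (homogeneousSubmodule (Fin 3) K)) {F : MvPolynomial (Fin 3) K}
    (hF : IsLine F) (t : ℤ) : hilbertInt (Submodule.colon I {F}) (t - 1) ≤ hilbertInt I t := by
  rcases le_or_gt t 0 with h | h
  · rw [hilbertInt_of_neg _ (by omega)]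
    exact hilbertInt_nonneg _ _
  · obtain ⟨k, rfl⟩ : ∃ k : ℕ, t = (k + 1 : ℕ) := ⟨(t - 1).toNat, by omega⟩
    rw [show ((k + 1 : ℕ) : ℤ) - 1 = k by push_cast; ring, hilbertInt_natCast,
      hilbertInt_natCast]
    have h1 := hilbertIdeal_sup_add_hilbertIdeal_colon hI hF k
    -- `I + (F)` contains `(F)`, so it has at least `binom (k + 2) 2` forms of degree `k + 1`.
    have h4 := finrank_restrictForms_add hF
      (Ideal.mem_sup_right (Ideal.mem_span_singleton_self F) : F ∈ I ⊔ Ideal.span {F}) (k + 1)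
    rw [show k + 1 + 1 = k + 2 from rfl] at h4
    omega

/-- The forms of degree `t` in `I`, restricted to the line `F = 0`, vanish on a scheme of
degree `d`. -/
theorem hilbertInt_le [IsAlgClosed K] {I : Ideal (MvPolynomial (Fin 3) K)}
    (hI : I.IsHomogeneous (homogeneousSubmodule (Fin 3) K)) {F : MvPolynomial (Fin 3) K}
    (hF : IsLine F) {d : ℤ} (hd : HasDegree (I ⊔ Ideal.span {F}) d) (t : ℤ) :
    hilbertInt I t ≤ hilbertInt (Submodule.colon I {F}) (t - 1) + max (t - d + 1) 0 := by
  rcases lt_or_ge t 0 with h | h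
  · rw [hilbertInt_of_neg _ h, hilbertInt_of_neg _ (by omega)]
    omega
  obtain ⟨s, rfl⟩ := Int.eq_ofNat_of_zero_le h
  have hmin := min_le_hilbertScheme hF
    (Ideal.mem_sup_right (Ideal.mem_span_singleton_self F) : F ∈ I ⊔ Ideal.span {F}) hd s
  have h2 := hilbertScheme_add_hilbertIdeal (I ⊔ Ideal.span {F}) s
  cases s with
  | zero =>
    rw [hilbertInt_natCast, hilbertInt_of_neg _ (by simp)]
    have h1 := hilbertIdeal_sup_zero hI hF
    have h3 : Nat.choose (0 + 2) 2 = 1 := by decide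
    omega
  | succ k =>
    rw [show ((k + 1 : ℕ) : ℤ) - 1 = k by push_cast; ring, hilbertInt_natCast,
      hilbertInt_natCast]
    have h1 := hilbertIdeal_sup_add_hilbertIdeal_colon hI hF k
    have h4 := choose_two_succ (k + 1)
    rw [show k + 1 + 1 = k + 2 by rfl] at h4
    omega

theorem hilbertInt_le_upperBound [IsAlgClosed K] {I : Ideal (MvPolynomial (Fin 3) K)}
    (hI : I.IsHomogeneous (homogeneousSubmodule (Fin 3) K)) {n : ℕ}
    {F : Fin (n + 1) → MvPolynomial (Fin 3) K} (hF : ∀ j, IsLine (F j))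
    (hred : TotallyReduces I F) {d : Fin (n + 1) → ℤ} (hd : IsReductionVector I F d) (t : ℤ) :
    hilbertInt I t ≤ upperBound d t := by
  have h := sum_telescope fun j : Fin (n + 2) => hilbertInt (residualIdeal I F j) (t - (j : ℤ))
  have hle : ∀ j : Fin (n + 1),
      hilbertInt (residualIdeal I F j.castSucc) (t - ((j.castSucc : ℕ) : ℤ)) -
        hilbertInt (residualIdeal I F j.succ) (t - ((j.succ : ℕ) : ℤ)) ≤
      binom (t - (j : ℤ) - d j + 1) 1 := fun j => by
    have := hilbertInt_le (isHomogeneous_residualIdeal hI hF j.castSucc) (hF j) (hd j)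
      (t - (j : ℤ))
    rw [residualIdeal_succ, binom_one, Fin.val_castSucc, Fin.val_succ,
      show t - ((j + 1 : ℕ) : ℤ) = t - (j : ℤ) - 1 by push_cast; ring]
    omega
  have hsum := Finset.sum_le_sum fun j (_ : j ∈ Finset.univ) => hle j
  rw [h, hred, hilbertInt_top] at hsum
  rw [upperBound, show t - (n : ℤ) + 1 = t - ((Fin.last (n + 1) : ℕ) : ℤ) + 2 by
    rw [Fin.val_last]; push_cast; ring]
  have h0 : hilbertInt (residualIdeal I F 0) (t - ((0 : Fin (n + 2)) : ℕ)) = hilbertInt I t := by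
    rw [Fin.val_zero, Nat.cast_zero, sub_zero]
    rfl
  rw [h0] at hsum
  linarith

theorem hilbertInt_residualIdeal_le {I : Ideal (MvPolynomial (Fin 3) K)}
    (hI : I.IsHomogeneous (homogeneousSubmodule (Fin 3) K)) {N : ℕ}
    {F : Fin N → MvPolynomial (Fin 3) K} (hF : ∀ j, IsLine (F j)) (t : ℤ) (i : Fin (N + 1)) :
    hilbertInt (residualIdeal I F i) (t - (i : ℤ)) ≤ hilbertInt I t := by
  induction i using Fin.induction with
  | zero => simp [residualIdeal]
  | succ j ih =>
    refine le_trans ?_ ih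
    rw [residualIdeal_succ, Fin.val_succ, Fin.val_castSucc,
      show t - ((j + 1 : ℕ) : ℤ) = t - (j : ℤ) - 1 by push_cast; ring]
    exact hilbertInt_colon_le (isHomogeneous_residualIdeal hI hF _) (hF j) _

/-- A scheme missed by some line imposes at most as many conditions on forms as its degree. -/
theorem le_hilbertInt_of_hasDegree {I : Ideal (MvPolynomial (Fin 3) K)}
    (hmono : Monotone (hilbertScheme I)) {D : ℤ} (hD : HasDegree I D) (t : ℤ) :
    binom (t + 2) 2 - D ≤ hilbertInt I t := by
  have hle : ∀ s : ℕ, (hilbertScheme I s : ℤ) ≤ D := fun s => by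
    obtain ⟨u, hu, hsu⟩ := (hD.and (Filter.eventually_ge_atTop s)).exists
    rw [← hu]
    exact_mod_cast hmono hsu
  rcases le_or_gt 0 t with h | h
  · obtain ⟨s, rfl⟩ := Int.eq_ofNat_of_zero_le h
    rw [hilbertInt_natCast, binom_natCast_add_two]
    have := hilbertScheme_add_hilbertIdeal I s
    have := hle s
    omega
  · rw [hilbertInt_of_neg _ h, binom, Nat.choose_eq_zero_of_lt (by omega)]
    have := hle 0
    omega

theorem lowerTerm_le_hilbertInt [Infinite K] {r n : ℕ}
    (p : Fin r → Projectivization K (Fin 3 → K)) (m : Fin r → ℕ)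
    {F : Fin (n + 1) → MvPolynomial (Fin 3) K} (hF : ∀ j, IsLine (F j))
    (hred : TotallyReduces (fatPointIdeal p m) F) {d : Fin (n + 1) → ℤ}
    (hd : IsReductionVector (fatPointIdeal p m) F d) (t : ℤ) (i : Fin (n + 2)) :
    lowerTerm d t i ≤ hilbertInt (fatPointIdeal p m) t := by
  obtain ⟨l, hl, hlp⟩ := exists_line_forall_eval_ne_zero p
  have hI := isHomogeneous_fatPointIdeal p m
  exact (le_hilbertInt_of_hasDegree
    (hilbertScheme_mono (isHomogeneous_residualIdeal hI hF i) hl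
      (colon_residualIdeal_fatPointIdeal m hl hlp F i))
    (hasDegree_residualIdeal hI hF hred hd i) _).trans (hilbertInt_residualIdeal_le hI hF t i)

end Reduction

end FatPoints

theorem mainTheorem2 {K : Type*} [Field K] [IsAlgClosed K] {r n : ℕ}
    (p : Fin r → Projectivization K (Fin 3 → K)) (m : Fin r → ℕ)
    (F : Fin (n + 1) → MvPolynomial (Fin 3) K) (hF : ∀ j, FatPoints.IsLine (F j))
    (hred : FatPoints.TotallyReduces (FatPoints.fatPointIdeal p m) F)
    (d : Fin (n + 1) → ℤ)
    (hd : FatPoints.IsReductionVector (FatPoints.fatPointIdeal p m) F d)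
    (hGMS : FatPoints.IsGMS d) :
    (∀ t : ℤ, FatPoints.lowerBound d t = FatPoints.upperBound d t) ∧
    (∀ t : ℕ, (FatPoints.hilbertIdeal (FatPoints.fatPointIdeal p m) t : ℤ) =
      FatPoints.lowerBound d t) ∧
    (∀ t : ℕ, (FatPoints.hilbertIdeal (FatPoints.fatPointIdeal p m) t : ℤ) =
      FatPoints.upperBound d t) ∧
    (∀ t : ℕ, (FatPoints.hilbertScheme (FatPoints.fatPointIdeal p m) t : ℤ) =
      FatPoints.binom (t + 2) 2 - FatPoints.upperBound d t) := by
  have : Infinite K := IsAlgClosed.instInfinite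
  have hbound := FatPoints.lowerBound_eq_upperBound hGMS
  have hupper : ∀ t : ℕ, (FatPoints.hilbertIdeal (FatPoints.fatPointIdeal p m) t : ℤ) =
      FatPoints.upperBound d t := fun t => by
    rw [← FatPoints.hilbertInt_natCast]
    refine le_antisymm (FatPoints.hilbertInt_le_upperBound
      (FatPoints.isHomogeneous_fatPointIdeal p m) hF hred hd t) ?_
    rw [← hbound]
    exact Finset.sup'_le _ _ fun i _ => FatPoints.lowerTerm_le_hilbertInt p m hF hred hd t i
  refine ⟨hbound, fun t => (hupper t).trans (hbound t).symm, hupper, fun t => ?_⟩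
  rw [← hupper, FatPoints.binom_natCast_add_two, ← FatPoints.hilbertScheme_add_hilbertIdeal
    (FatPoints.fatPointIdeal p m) t]
  push_cast
  ring
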